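/- Let $1\le k<n$, let $\mathbb S^n$ be the space of real symmetric $n\times n$ matrices with the inner product $\langle A,B\rangle=\mathrm{Tr}(AB)$, Frobenius norm $\|\cdot\|_F$ and spectral norm $\|\cdot\|$, and let $\lambda_i(A)$ be the $i$-th largest eigenvalue of $A\in\mathbb S^n$. Let $f:\mathbb S^n\to\mathbb R$ be convex and $\beta$-smooth, i.e. differentiable with $\|\nabla f(X)-\nabla f(Y)\|_F\le\beta\|X-Y\|_F$ for all $X,Y\in\mathbb S^n$. Let $\mathcal F_{n,k}=\{X\in\mathbb S^n : I\succeq X\succeq 0,\ \mathrm{Tr}(X)=k\}$, and let $X^*$ be a minimizer of $f$ over $\mathcal F_{n,k}$ such that, for some $\delta>0$, $\lambda_{n-k}(\nabla f(X^*))-\lambda_{n-k+1}(\nabla f(X^*))\ge\delta$. Let $G\ge\sup_{X\in\mathcal F_{n,k}}\|\nabla f(X)\|$ and $\eta=\frac{1}{5\max\{\beta,G\}}$. Let $Q_1\in\mathbb R^{n\times k}$ satisfy $Q_1^\top Q_1=I$ and $$\|Q_1Q_1^\top-X^*\|_F\le\min\Big\{1,\sqrt{\tfrac{\delta}{2}}\Big\}\,\frac{\eta\delta}{2(1+\eta\beta)},$$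 and let $(Q_t)_{t\ge1}$ be any sequence generated by the gradient orthogonal iteration: for every $t\ge1$, $(Q_{t+1},R_{t+1})$ is a QR factorization of $Q_t-\eta\nabla f(Q_tQ_t^\top)Q_t$, i.e. $Q_{t+1}R_{t+1}=Q_t-\eta\nabla f(Q_tQ_t^\top)Q_t$ with $Q_{t+1}\in\mathbb R^{n\times k}$, $Q_{t+1}^\top Q_{t+1}=I$ and $R_{t+1}\in\mathbb R^{k\times k}$ upper triangular. Then for all $t\ge1$, $$f(Q_tQ_t^\top)-f(X^*)\le\big(f(Q_1Q_1^\top)-f(X^*)\big)\exp\Big(-\frac{\delta(t-1)}{40\max\{\beta,G\}}\Big).$$ -/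

import Mathlib

open Matrix

/- Matrices carry the Frobenius norm `‖A‖ = (∑ i j, A i j ^ 2) ^ (1 / 2)` throughout. -/
attribute [local instance] Matrix.frobeniusNormedAddCommGroup Matrix.frobeniusNormedSpace

/-- The standard inner product `⟨A, B⟩ = Tr (Aᵀ B)` on real matrices, inducing the Frobenius norm. -/
noncomputable abbrev frobeniusInnerProductSpace (m n : Type*) [Fintype m] [Fintype n] :
    InnerProductSpace ℝ (Matrix m n ℝ) where
  inner A B := (Aᵀ * B).trace
  norm_sq_eq_re_inner A := by
    have h0 : (0 : ℝ) ≤ ∑ i, ∑ j, A i j ^ 2 :=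
      Finset.sum_nonneg fun i _ => Finset.sum_nonneg fun j _ => sq_nonneg _
    have h1 : ‖A‖ = Real.sqrt (∑ i, ∑ j, A i j ^ 2) := by
      rw [Matrix.frobenius_norm_def, Real.sqrt_eq_rpow]
      simp
    rw [h1, Real.sq_sqrt h0, Finset.sum_comm]
    simp [Matrix.trace, Matrix.mul_apply, sq]
  conj_inner_symm A B := by
    rw [← Matrix.trace_transpose (Bᵀ * A)]
    simp [Matrix.transpose_mul]
  add_left A B C := by simp [Matrix.add_mul]
  smul_left A B r := by simp

attribute [local instance] frobeniusInnerProductSpace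

/-- The symmetric matrices as a linear subspace of all real `n × n` matrices. -/
def symSubmodule (n : ℕ) : Submodule ℝ (Matrix (Fin n) (Fin n) ℝ) where
  carrier := {A | A.IsSymm}
  add_mem' hA hB := Matrix.IsSymm.add hA hB
  zero_mem' := Matrix.isSymm_zero
  smul_mem' c _ hA := Matrix.IsSymm.smul hA c

/-- The space `𝕊ⁿ` of real symmetric `n × n` matrices, with the Frobenius inner product and norm. -/
abbrev SymMat (n : ℕ) : Type := symSubmodule n

theorem SymMat.isHermitian {n : ℕ} (A : SymMat n) :
    (A : Matrix (Fin n) (Fin n) ℝ).IsHermitian := by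
  have h : (A : Matrix (Fin n) (Fin n) ℝ)ᵀ = A := A.2
  rw [Matrix.IsHermitian, Matrix.conjTranspose_eq_transpose_of_trivial, h]

/-- `eig A i` is the `i`-th largest eigenvalue `λ_i(A)`, counted with multiplicity, for
`1 ≤ i ≤ n` (and `0` for other `i`). -/
noncomputable def eig {n : ℕ} (A : SymMat n) (i : ℕ) : ℝ :=
  if h : 1 ≤ i ∧ i ≤ n then
    A.isHermitian.eigenvalues₀ ⟨i - 1, by rw [Fintype.card_fin]; omega⟩
  else 0

/-- The spectral norm (largest singular value) of a symmetric matrix. -/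
noncomputable def spectralNorm₂ {n : ℕ} (A : SymMat n) : ℝ :=
  ‖Matrix.toEuclideanCLM (n := Fin n) (𝕜 := ℝ) (A : Matrix (Fin n) (Fin n) ℝ)‖

/-- The Fantope `{X ∈ 𝕊ⁿ | I ⪰ X ⪰ 0, Tr X = k}`. -/
def fantope (n k : ℕ) : Set (SymMat n) :=
  {X | (X : Matrix (Fin n) (Fin n) ℝ).PosSemidef ∧
    (1 - (X : Matrix (Fin n) (Fin n) ℝ)).PosSemidef ∧
    (X : Matrix (Fin n) (Fin n) ℝ).trace = k}

/-- `f` is differentiable on `𝕊ⁿ` with `β`-Lipschitz gradient (in the Frobenius norm). -/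
def IsSmoothWith {n : ℕ} (f : SymMat n → ℝ) (β : ℝ) : Prop :=
  Differentiable ℝ f ∧ ∀ X Y, ‖gradient f X - gradient f Y‖ ≤ β * ‖X - Y‖

/-- `X` is an optimal solution of `min f` over the Fantope. -/
def IsFantopeOptimal {n : ℕ} (f : SymMat n → ℝ) (k : ℕ) (X : SymMat n) : Prop :=
  X ∈ fantope n k ∧ ∀ Y ∈ fantope n k, f X ≤ f Y

/-- The eigengap condition `λ_{n-k}(∇f(X)) - λ_{n-k+1}(∇f(X)) ≥ δ`. -/
def HasEigengap {n : ℕ} (f : SymMat n → ℝ) (k : ℕ) (X : SymMat n) (δ : ℝ) : Prop :=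
  δ ≤ eig (gradient f X) (n - k) - eig (gradient f X) (n - k + 1)

/-- The symmetric matrix `Q Qᵀ`. -/
def outer {n k : ℕ} (Q : Matrix (Fin n) (Fin k) ℝ) : SymMat n :=
  ⟨Q * Qᵀ, by
    change (Q * Qᵀ)ᵀ = Q * Qᵀ
    rw [Matrix.transpose_mul, Matrix.transpose_transpose]⟩

/-- `(Q, R)` is a (thin) QR factorization of `Z`: `Z = Q R`, where `Q` has orthonormal columns and
`R` is upper triangular. -/
def IsQR {n k : ℕ} (Z Q : Matrix (Fin n) (Fin k) ℝ) (R : Matrix (Fin k) (Fin k) ℝ) : Prop :=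
  Qᵀ * Q = 1 ∧ R.BlockTriangular id ∧ Q * R = Z

/-- `Q 1, Q 2, …` is generated by the gradient orthogonal iteration with step size `η`, started from
a matrix `Q 1` with orthonormal columns: `Q (t + 1)` is a Q-factor of some QR factorization of
`Q t - η ∇f(Q t (Q t)ᵀ) Q t`. (The value `Q 0` plays no role.) -/
def IsGradientOrthogonalIteration {n k : ℕ} (f : SymMat n → ℝ) (η : ℝ)
    (Q : ℕ → Matrix (Fin n) (Fin k) ℝ) : Prop :=
  (Q 1)ᵀ * Q 1 = 1 ∧
    ∀ t, 1 ≤ t → ∃ R,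
      IsQR (Q t - η • ((gradient f (outer (Q t)) : SymMat n).1 * Q t)) (Q (t + 1)) R

/-! ### Smooth convex functions on a Hilbert space. -/

section SmoothConvex

variable {E : Type*} [NormedAddCommGroup E] [InnerProductSpace ℝ E] [CompleteSpace E]

/-! Put `M = max β G`, so that `η * M = 1 / 5`, and let `P = Q Qᵀ`, `g = ∇f(P)`. First-order
optimality and the eigengap force `X*` to be the bottom eigenprojection of its own gradient, whence
quadratic growth: the gap `f(P) - f(X*)` is at least `δ * s`, with `s = ‖P - X*‖² / 2`
(`IsFantopeOptimal.spectral_bounds`).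

Near `X*` a Polyak–Łojasiewicz inequality holds: the gap is at most a constant times `o² / δ`, where
`o = ‖(1 - P) g P‖` measures how far `range P` is from being `g`-invariant. It comes from a block
expansion of `⟨g, P - X*⟩` (`Matrix.trace_mul_sub_proj_le`); the change of gradient is absorbed by
the extra term in `ConvexOn.add_inner_gradient_add_sq_le`.

A step to `P'` satisfies `o ≤ 6M‖P' - P‖` and `⟨g, P' - P⟩ ≤ -4M‖P' - P‖²`
(`Matrix.iteration_step_bounds`), so the descent lemma gains `(7/2) M‖P' - P‖²`. Combining, the gap
shrinks by the factor `1 - δ / (40 * M)`. A smaller gap keeps the iterate in the region where this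
applies, so induction finishes. -/

theorem hasDerivAt_comp_line {f : E → ℝ} (hf : Differentiable ℝ f) (x d : E) (t : ℝ) :
    HasDerivAt (fun s : ℝ => f (x + s • d)) (inner ℝ (gradient f (x + t • d)) d) t := by
  have h1 : HasDerivAt (fun s : ℝ => x + s • d) d t := by
    simpa using ((hasDerivAt_id t).smul_const d).const_add x
  have h2 := (hf (x + t • d)).hasFDerivAt.comp_hasDerivAt t h1
  rwa [← inner_gradient_left] at h2

theorem ConvexOn.add_inner_gradient_le {f : E → ℝ} (hc : ConvexOn ℝ Set.univ f)
    (hf : Differentiable ℝ f) (x y : E) : f x + inner ℝ (gradient f x) (y - x) ≤ f y := by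
  have hline : ConvexOn ℝ Set.univ (fun s : ℝ => f (x + s • (y - x))) := by
    have h := hc.comp_affineMap (AffineMap.lineMap x y : ℝ →ᵃ[ℝ] E)
    have e : f ∘ (AffineMap.lineMap x y : ℝ →ᵃ[ℝ] E) = fun s : ℝ => f (x + s • (y - x)) := by
      funext s
      simp [AffineMap.lineMap_apply, add_comm]
    rwa [e, Set.preimage_univ] at h
  have h := hline.le_slope_of_hasDerivAt (Set.mem_univ 0) (Set.mem_univ 1) one_pos
    (hasDerivAt_comp_line hf x (y - x) 0)
  simp only [slope_def_field, zero_smul, add_zero, one_smul, add_sub_cancel, sub_zero,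
    div_one] at h
  linarith

theorem le_add_inner_gradient_add_sq {f : E → ℝ} {M : ℝ} (hf : Differentiable ℝ f)
    (hM : ∀ x y, ‖gradient f x - gradient f y‖ ≤ M * ‖x - y‖) (x y : E) :
    f y ≤ f x + inner ℝ (gradient f x) (y - x) + M / 2 * ‖y - x‖ ^ 2 := by
  set d := y - x with hd
  set φ : ℝ → ℝ := fun t =>
    f (x + t • d) - t * inner ℝ (gradient f x) d - M / 2 * ‖d‖ ^ 2 * t ^ 2 with hφ
  have hder : ∀ t, HasDerivAt φ (inner ℝ (gradient f (x + t • d)) d - inner ℝ (gradient f x) d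
      - M * ‖d‖ ^ 2 * t) t := by
    intro t
    have h := ((hasDerivAt_comp_line hf x d t).sub
      ((hasDerivAt_id t).mul_const (inner ℝ (gradient f x) d))).sub
      (((hasDerivAt_id t).pow 2).const_mul (M / 2 * ‖d‖ ^ 2))
    refine h.congr_deriv ?_
    norm_num
    ring
  have hanti : AntitoneOn φ (Set.Icc 0 1) := by
    apply antitoneOn_of_deriv_nonpos (convex_Icc 0 1)
    · exact fun t _ => (hder t).continuousAt.continuousWithinAt
    · exact fun t _ => (hder t).differentiableAt.differentiableWithinAt
    · intro t ht
      rw [interior_Icc] at ht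
      rw [(hder t).deriv, ← inner_sub_left]
      have h1 := real_inner_le_norm (gradient f (x + t • d) - gradient f x) d
      have h2 := hM (x + t • d) x
      rw [add_sub_cancel_left, norm_smul, Real.norm_of_nonneg ht.1.le] at h2
      nlinarith [mul_le_mul_of_nonneg_right h2 (norm_nonneg d)]
  have h := hanti (Set.left_mem_Icc.2 zero_le_one) (Set.right_mem_Icc.2 zero_le_one) zero_le_one
  simp only [hφ, hd, zero_smul, add_zero, one_smul, add_sub_cancel] at h
  linarith

/-- Compare the tangent plane at `x` with the quadratic upper bound at `y`, both at `y + z`. The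
choice `z = M⁻¹ • e` maximizes `⟨e, z⟩ - M / 2 * ‖z‖²`. -/
theorem ConvexOn.add_inner_gradient_add_sq_le {f : E → ℝ} {M : ℝ} (hM0 : 0 < M)
    (hc : ConvexOn ℝ Set.univ f) (hf : Differentiable ℝ f)
    (hM : ∀ x y, ‖gradient f x - gradient f y‖ ≤ M * ‖x - y‖) (x y : E) :
    f x + inner ℝ (gradient f x) (y - x) + ‖gradient f x - gradient f y‖ ^ 2 / (2 * M) ≤ f y := by
  set e := gradient f x - gradient f y with he
  have h1 := hc.add_inner_gradient_le hf x (y + M⁻¹ • e)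
  have h2 := le_add_inner_gradient_add_sq hf hM y (y + M⁻¹ • e)
  have h3 : inner ℝ (gradient f x) e - inner ℝ (gradient f y) e = ‖e‖ ^ 2 := by
    rw [← inner_sub_left, ← he, real_inner_self_eq_norm_sq]
  rw [add_sub_right_comm, inner_add_right, inner_smul_right] at h1
  rw [add_sub_cancel_left, inner_smul_right, norm_smul, Real.norm_of_nonneg (by positivity)] at h2
  have h4 : M / 2 * (M⁻¹ * ‖e‖) ^ 2 = ‖e‖ ^ 2 / (2 * M) := by field_simp
  have h5 : M⁻¹ * inner ℝ (gradient f x) e - M⁻¹ * inner ℝ (gradient f y) e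
      = 2 * (‖e‖ ^ 2 / (2 * M)) := by rw [← mul_sub, h3]; field_simp
  linarith

theorem inner_gradient_nonneg_of_isMinOn {f : E → ℝ} {s : Set E} (hs : Convex ℝ s)
    (hf : Differentiable ℝ f) {x y : E} (hx : x ∈ s) (hy : y ∈ s) (hmin : ∀ z ∈ s, f x ≤ f z) :
    0 ≤ inner ℝ (gradient f x) (y - x) := by
  rw [inner_gradient_left]
  have h : IsMinOn f s x := fun z hz => hmin z hz
  exact h.localize.hasFDerivWithinAt_nonneg
    (hf x).hasFDerivAt.hasFDerivWithinAt
    (sub_mem_posTangentConeAt_of_segment_subset (hs.segment_subset hx hy))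

end SmoothConvex

/-! ### Frobenius norm estimates. -/

section Frobenius

variable {l m n : Type*} [Fintype l] [Fintype m] [Fintype n]

theorem Matrix.inner_eq_trace (A B : Matrix m n ℝ) : inner ℝ A B = (Aᵀ * B).trace := rfl

theorem Matrix.frobenius_norm_sq_eq_trace (A : Matrix m n ℝ) : ‖A‖ ^ 2 = (Aᵀ * A).trace :=
  (real_inner_self_eq_norm_sq A).symm

theorem Matrix.frobenius_norm_sq_eq_sum (A : Matrix m n ℝ) : ‖A‖ ^ 2 = ∑ j, ∑ i, A i j ^ 2 := by
  rw [Matrix.frobenius_norm_sq_eq_trace]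
  simp [Matrix.trace, Matrix.mul_apply, sq]

theorem Matrix.frobenius_norm_proj_mul_le [DecidableEq m] {P : Matrix m m ℝ} (hs : Pᵀ = P)
    (hi : P * P = P) (C : Matrix m n ℝ) : ‖P * C‖ ≤ ‖C‖ := by
  have h : ‖C‖ ^ 2 = ‖P * C‖ ^ 2 + ‖(1 - P) * C‖ ^ 2 := by
    simp only [Matrix.frobenius_norm_sq_eq_trace, ← Matrix.trace_add]
    congr 1
    have e : (P * C)ᵀ * (P * C) = Cᵀ * ((P * P) * C) := by
      rw [Matrix.transpose_mul, hs]; simp only [Matrix.mul_assoc]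
    have e' : ((1 - P) * C)ᵀ * ((1 - P) * C) = Cᵀ * (((1 - P) * (1 - P)) * C) := by
      rw [Matrix.transpose_mul, Matrix.transpose_sub, hs, Matrix.transpose_one]
      simp only [Matrix.mul_assoc]
    have e'' : (1 - P) * (1 - P) = 1 - P := by
      rw [Matrix.sub_mul, Matrix.mul_sub, Matrix.mul_sub, hi]; simp
    rw [e, e', e'', hi, ← Matrix.mul_add, ← Matrix.add_mul]
    simp
  exact (abs_le_of_sq_le_sq' (by nlinarith [sq_nonneg ‖(1 - P) * C‖]) (norm_nonneg _)).2

theorem Matrix.frobenius_norm_mul_proj_le [DecidableEq n] {P : Matrix n n ℝ} (hs : Pᵀ = P)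
    (hi : P * P = P) (C : Matrix m n ℝ) : ‖C * P‖ ≤ ‖C‖ := by
  have h := Matrix.frobenius_norm_proj_mul_le hs hi Cᵀ
  rwa [← hs, ← Matrix.transpose_mul, Matrix.frobenius_norm_transpose,
    Matrix.frobenius_norm_transpose] at h

theorem Matrix.frobenius_norm_mul_le_opNorm [DecidableEq m] (A : Matrix m m ℝ)
    (C : Matrix m n ℝ) :
    ‖A * C‖ ≤ ‖Matrix.toEuclideanCLM (n := m) (𝕜 := ℝ) A‖ * ‖C‖ := by
  set N := ‖Matrix.toEuclideanCLM (n := m) (𝕜 := ℝ) A‖ with hN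
  have hN0 : 0 ≤ N := norm_nonneg _
  refine (abs_le_of_sq_le_sq' ?_ (by positivity)).2
  rw [mul_pow, Matrix.frobenius_norm_sq_eq_sum, Matrix.frobenius_norm_sq_eq_sum, Finset.mul_sum]
  refine Finset.sum_le_sum fun j _ => ?_
  have h := (Matrix.toEuclideanCLM (n := m) (𝕜 := ℝ) A).le_opNorm (WithLp.toLp 2 (C.col j))
  have h2 := pow_le_pow_left₀ (norm_nonneg _) h 2
  rw [mul_pow, EuclideanSpace.real_norm_sq_eq, EuclideanSpace.real_norm_sq_eq] at h2
  simpa [Matrix.mulVec, dotProduct, Matrix.mul_apply] using h2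

theorem Matrix.PosSemidef.transpose_mul_self_real (A : Matrix m n ℝ) : (Aᵀ * A).PosSemidef := by
  have h := Matrix.posSemidef_conjTranspose_mul_self A
  rwa [Matrix.conjTranspose_eq_transpose_of_trivial] at h

end Frobenius

/-! ### Diagonalization and ordered eigenvalues. -/

section Spectral

variable {n : ℕ}

theorem Matrix.IsHermitian.exists_orthogonal_diagonalization {ι : Type*} [Fintype ι]
    [DecidableEq ι] {A : Matrix ι ι ℝ} (hA : A.IsHermitian) :
    ∃ V : Matrix ι ι ℝ, Vᵀ * V = 1 ∧ V * Vᵀ = 1 ∧ A = V * Matrix.diagonal hA.eigenvalues * Vᵀ := by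
  have h1 := Unitary.coe_star_mul_self hA.eigenvectorUnitary
  have h2 := Unitary.coe_mul_star_self hA.eigenvectorUnitary
  have h3 := hA.spectral_theorem
  simp only [Matrix.star_eq_conjTranspose, Matrix.conjTranspose_eq_transpose_of_trivial] at h1 h2
  refine ⟨hA.eigenvectorUnitary, h1, h2, ?_⟩
  rw [Unitary.conjStarAlgAut_apply] at h3
  simpa [Matrix.star_eq_conjTranspose, Matrix.conjTranspose_eq_transpose_of_trivial,
    Function.comp_def] using h3

theorem Matrix.trace_conj_diagonal_mul {ι : Type*} [Fintype ι] [DecidableEq ι]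
    (V W : Matrix ι ι ℝ) (d : ι → ℝ) :
    (V * Matrix.diagonal d * Vᵀ * W).trace = ∑ i, d i * (Vᵀ * W * V) i i := by
  have : (V * Matrix.diagonal d * Vᵀ * W).trace = (Matrix.diagonal d * (Vᵀ * W * V)).trace := by
    rw [Matrix.mul_assoc, Matrix.mul_assoc, Matrix.trace_mul_comm]
    simp only [Matrix.mul_assoc]
  rw [this]
  simp [Matrix.trace, Matrix.diagonal_mul]

theorem Matrix.IsHermitian.abs_eigenvalues_le {ι : Type*} [Fintype ι]
    [DecidableEq ι] {A : Matrix ι ι ℝ} (hA : A.IsHermitian) (i : ι) :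
    |hA.eigenvalues i| ≤ ‖Matrix.toEuclideanCLM (n := ι) (𝕜 := ℝ) A‖ := by
  have h := (Matrix.toEuclideanCLM (n := ι) (𝕜 := ℝ) A).le_opNorm (hA.eigenvectorBasis i)
  have e : Matrix.toEuclideanCLM (n := ι) (𝕜 := ℝ) A (hA.eigenvectorBasis i)
      = hA.eigenvalues i • hA.eigenvectorBasis i := by
    apply PiLp.ext
    intro j
    have := congrFun (hA.mulVec_eigenvectorBasis i) j
    simpa using this
  rw [e, norm_smul, hA.eigenvectorBasis.orthonormal.norm_eq_one] at h
  simpa using h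

/-- The eigenvalues of `A`, split into the `k` smallest ones (indexed by `s`) and the others. -/
theorem exists_eigenvalues_split {k : ℕ} (hk : 1 ≤ k) (hkn : k < n) (A : SymMat n) :
    ∃ s : Finset (Fin n), s.card = k ∧
      (∀ i ∈ s, A.isHermitian.eigenvalues i ≤ eig A (n - k + 1)) ∧
      ∀ i ∉ s, eig A (n - k) ≤ A.isHermitian.eigenvalues i := by
  set e : Fin n ≃ Fin (Fintype.card (Fin n)) :=
    (Fintype.equivOfCardEq (Fintype.card_fin _)).symm with he
  -- `e i` is the 0-based position of `eigenvalues i` in decreasing order, so `eig A (n - k + 1)`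
  -- sits at position `n - k`.
  refine ⟨Finset.univ.filter fun i => n - k ≤ (e i : ℕ), ?_, ?_, ?_⟩
  · have h1 : (Finset.univ.filter fun i => n - k ≤ (e i : ℕ)).card
        = (Finset.univ.filter fun i : Fin (Fintype.card (Fin n)) => n - k ≤ (i : ℕ)).card := by
      apply Finset.card_bij (fun i _ => e i)
      · simp
      · intro a _ b _ h
        exact e.injective h
      · intro b hb
        exact ⟨e.symm b, by simpa using hb, by simp⟩
    rw [h1]
    have h2 : (Finset.univ.filter fun i : Fin (Fintype.card (Fin n)) => n - k ≤ (i : ℕ)).map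
        Fin.valEmbedding = Finset.Ico (n - k) n := by
      ext x
      simp only [Finset.mem_map, Finset.mem_filter, Finset.mem_univ, true_and,
        Fin.valEmbedding_apply, Finset.mem_Ico]
      constructor
      · rintro ⟨a, ha, rfl⟩
        exact ⟨ha, by simpa using a.2⟩
      · rintro ⟨h, h'⟩
        exact ⟨⟨x, by simpa using h'⟩, h, rfl⟩
    rw [← Finset.card_map Fin.valEmbedding, h2, Nat.card_Ico]
    omega
  · intro i hi
    rw [eig, dif_pos (by omega)]
    apply A.isHermitian.eigenvalues₀_antitone
    simpa [Fin.le_def] using hi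
  · intro i hi
    rw [eig, dif_pos (by omega)]
    apply A.isHermitian.eigenvalues₀_antitone
    simp only [Finset.mem_filter, Finset.mem_univ, true_and, not_le] at hi
    rw [Fin.le_def]
    change (e i : ℕ) ≤ n - k - 1
    omega

end Spectral

/-! ### The bottom eigenprojection and the minimizer. -/

section EigenProjection

theorem Matrix.PosSemidef.trace_mul_nonneg_real {ι : Type*} [Fintype ι] [DecidableEq ι]
    {A B : Matrix ι ι ℝ} (hA : A.PosSemidef) (hB : B.PosSemidef) : 0 ≤ (A * B).trace := by
  obtain ⟨V, -, -, hV⟩ := hA.isHermitian.exists_orthogonal_diagonalization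
  rw [hV, Matrix.trace_conj_diagonal_mul]
  refine Finset.sum_nonneg fun i _ => mul_nonneg (hA.eigenvalues_nonneg i) ?_
  have h := hB.conjTranspose_mul_mul_same V
  rw [Matrix.conjTranspose_eq_transpose_of_trivial] at h
  exact h.diag_nonneg

variable {n : ℕ}

/-- The projection onto the span of eigenvectors for the `k` smallest eigenvalues of `A`, with the
bounds on the linear functional `Tr (A W)` that it gives. -/
theorem exists_bottom_eigenprojection {k : ℕ} (hk : 1 ≤ k) (hkn : k < n) (A : SymMat n) {M : ℝ}
    (hM : spectralNorm₂ A ≤ M) :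
    ∃ P : Matrix (Fin n) (Fin n) ℝ, Pᵀ = P ∧ P * P = P ∧ P.trace = k ∧
      (∀ W : Matrix (Fin n) (Fin n) ℝ, W.PosSemidef →
        (A.1 * W).trace ≤ eig A (n - k + 1) * W.trace +
          (M - eig A (n - k + 1)) * (W.trace - (P * W).trace) ∧
        eig A (n - k) * W.trace - (eig A (n - k) + M) * (P * W).trace ≤ (A.1 * W).trace) ∧
      ∀ X ∈ fantope n k,
        (eig A (n - k) - eig A (n - k + 1)) * (k - (P * X.1).trace) ≤
          (A.1 * X.1).trace - (A.1 * P).trace ∧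
        (A.1 * X.1).trace - (A.1 * P).trace ≤ 2 * M * (k - (P * X.1).trace) := by
  obtain ⟨V, hV1, hV2, hA⟩ := A.isHermitian.exists_orthogonal_diagonalization
  obtain ⟨s, hcard, hlow, hhigh⟩ := exists_eigenvalues_split hk hkn A
  set ev := A.isHermitian.eigenvalues with hev
  set μ := eig A (n - k + 1) with hμ
  set ν := eig A (n - k) with hν
  have habs : ∀ i, -M ≤ ev i ∧ ev i ≤ M := fun i =>
    abs_le.1 ((A.isHermitian.abs_eigenvalues_le i).trans hM)
  -- In the eigenbasis all traces are weighted sums of the diagonal entries of `Vᵀ W V`, so each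
  -- bound can be checked entry by entry.
  set c : Fin n → ℝ := fun i => if i ∈ s then 1 else 0 with hc
  have hcsum : ∑ i, c i = k := by simp [hc, hcard]
  set P := V * Matrix.diagonal c * Vᵀ with hP
  have htrA : ∀ W, (A.1 * W).trace = ∑ i, ev i * (Vᵀ * W * V) i i := by
    intro W
    rw [← Matrix.trace_conj_diagonal_mul, ← hA]
  have htrP : ∀ W, (P * W).trace = ∑ i, c i * (Vᵀ * W * V) i i := fun W =>
    Matrix.trace_conj_diagonal_mul V W c
  have htr : ∀ W : Matrix (Fin n) (Fin n) ℝ, W.trace = ∑ i, (Vᵀ * W * V) i i := by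
    intro W
    change _ = (Vᵀ * W * V).trace
    rw [Matrix.trace_mul_comm, ← Matrix.mul_assoc, hV2, Matrix.one_mul]
  have hVPV : Vᵀ * P * V = Matrix.diagonal c := by
    have : Vᵀ * P * V = (Vᵀ * V) * Matrix.diagonal c * (Vᵀ * V) := by
      simp only [hP, Matrix.mul_assoc]
    rw [this, hV1, Matrix.one_mul, Matrix.mul_one]
  have hnonneg : ∀ W : Matrix (Fin n) (Fin n) ℝ, W.PosSemidef → ∀ i, 0 ≤ (Vᵀ * W * V) i i := by
    intro W hW i
    have := hW.conjTranspose_mul_mul_same V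
    rw [Matrix.conjTranspose_eq_transpose_of_trivial] at this
    exact this.diag_nonneg
  refine ⟨P, ?_, ?_, ?_, ?_, ?_⟩
  · simp [hP, Matrix.transpose_mul, Matrix.mul_assoc]
  · have h1 : P * P = V * Matrix.diagonal c * (Vᵀ * V) * Matrix.diagonal c * Vᵀ := by
      simp only [hP, Matrix.mul_assoc]
    rw [h1, hV1, Matrix.mul_one, Matrix.mul_assoc V, Matrix.diagonal_mul_diagonal]
    have : (fun i => c i * c i) = c := by
      funext i
      simp [hc]
    rw [this]
  · rw [htr, hVPV]
    simpa using hcsum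
  · intro W hW
    rw [htrA, htrP, htr W]
    constructor
    · rw [← Finset.sum_sub_distrib, Finset.mul_sum, Finset.mul_sum, ← Finset.sum_add_distrib]
      refine Finset.sum_le_sum fun i _ => ?_
      have hw := hnonneg W hW i
      by_cases hi : i ∈ s
      · simp only [hc, hi, if_true]
        nlinarith [mul_le_mul_of_nonneg_right (hlow i hi) hw]
      · simp only [hc, hi, if_false]
        nlinarith [mul_le_mul_of_nonneg_right (habs i).2 hw]
    · rw [Finset.mul_sum, Finset.mul_sum, ← Finset.sum_sub_distrib]
      refine Finset.sum_le_sum fun i _ => ?_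
      have hw := hnonneg W hW i
      by_cases hi : i ∈ s
      · simp only [hc, hi, if_true]
        nlinarith [mul_le_mul_of_nonneg_right (habs i).1 hw]
      · simp only [hc, hi, if_false]
        nlinarith [mul_le_mul_of_nonneg_right (hhigh i hi) hw]
  · rintro X ⟨hX0, hX1, hXt⟩
    have hx1 : ∀ i, (Vᵀ * X.1 * V) i i ≤ 1 := by
      intro i
      have h := hnonneg _ hX1 i
      rw [Matrix.mul_sub, Matrix.sub_mul, Matrix.mul_one, hV1] at h
      simpa using h
    -- The same deficit in two forms: the mass of `X` outside `s`, and the mass missing inside `s`.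
    -- They agree because `X` has trace `k = s.card`.
    have hsum : (k : ℝ) - (P * X.1).trace
        = ∑ i, ((Vᵀ * X.1 * V) i i - c i * (Vᵀ * X.1 * V) i i) := by
      rw [Finset.sum_sub_distrib, ← htr, ← htrP, hXt]
    have hsum' : (k : ℝ) - (P * X.1).trace = ∑ i, (c i - c i * (Vᵀ * X.1 * V) i i) := by
      rw [Finset.sum_sub_distrib, ← htrP, hcsum]
    have hdiff : (A.1 * X.1).trace - (A.1 * P).trace
        = ∑ i, ev i * ((Vᵀ * X.1 * V) i i - c i) := by
      rw [htrA, htrA P, hVPV, ← Finset.sum_sub_distrib]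
      refine Finset.sum_congr rfl fun i _ => ?_
      rw [Matrix.diagonal_apply_eq]
      ring
    constructor
    · rw [sub_mul]
      nth_rewrite 1 [hsum]
      rw [hsum', hdiff, Finset.mul_sum, Finset.mul_sum, ← Finset.sum_sub_distrib]
      refine Finset.sum_le_sum fun i _ => ?_
      have hw := hnonneg X.1 hX0 i
      by_cases hi : i ∈ s
      · simp only [hc, hi, if_true]
        nlinarith [mul_le_mul_of_nonneg_right (hlow i hi) (sub_nonneg.2 (hx1 i))]
      · simp only [hc, hi, if_false]
        nlinarith [mul_le_mul_of_nonneg_right (hhigh i hi) hw]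
    · rw [mul_assoc, two_mul]
      nth_rewrite 1 [hsum]
      rw [hsum', hdiff, Finset.mul_sum, Finset.mul_sum, ← Finset.sum_add_distrib]
      refine Finset.sum_le_sum fun i _ => ?_
      have hw := hnonneg X.1 hX0 i
      by_cases hi : i ∈ s
      · simp only [hc, hi, if_true]
        nlinarith [mul_le_mul_of_nonneg_right (habs i).1 (sub_nonneg.2 (hx1 i))]
      · simp only [hc, hi, if_false]
        nlinarith [mul_le_mul_of_nonneg_right (habs i).2 hw]

theorem convex_fantope (n k : ℕ) : Convex ℝ (fantope n k) := by
  rintro X ⟨hX0, hX1, hXt⟩ Y ⟨hY0, hY1, hYt⟩ a b ha hb hab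
  refine ⟨(hX0.smul ha).add (hY0.smul hb), ?_, ?_⟩
  · have h : (1 : Matrix (Fin n) (Fin n) ℝ) - (a • X + b • Y : SymMat n).1
        = a • (1 - X.1) + b • (1 - Y.1) := by
      nth_rewrite 1 [← one_smul ℝ (1 : Matrix (Fin n) (Fin n) ℝ), ← hab]
      change (a + b) • 1 - (a • X.1 + b • Y.1) = _
      module
    rw [h]
    exact (hX1.smul ha).add (hY1.smul hb)
  · change (a • X.1 + b • Y.1).trace = k
    rw [Matrix.trace_add, Matrix.trace_smul, Matrix.trace_smul, hXt, hYt, ← add_smul, hab, one_smul]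

theorem proj_mem_fantope {k : ℕ} {P : SymMat n} (hi : P.1 * P.1 = P.1) (ht : P.1.trace = k) :
    P ∈ fantope n k := by
  have hs : P.1ᵀ = P.1 := P.2
  refine ⟨?_, ?_, ht⟩
  · have h := Matrix.PosSemidef.transpose_mul_self_real P.1
    rwa [hs, hi] at h
  · have h := Matrix.PosSemidef.transpose_mul_self_real (1 - P.1)
    rwa [Matrix.transpose_sub, Matrix.transpose_one, hs, Matrix.sub_mul, Matrix.mul_sub,
      Matrix.mul_sub, hi, Matrix.one_mul, Matrix.one_mul, Matrix.mul_one, sub_self, sub_zero] at h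

theorem outer_mul_self {k : ℕ} {Q : Matrix (Fin n) (Fin k) ℝ} (hQ : Qᵀ * Q = 1) :
    (outer Q).1 * (outer Q).1 = (outer Q).1 := by
  change Q * Qᵀ * (Q * Qᵀ) = Q * Qᵀ
  rw [Matrix.mul_assoc, ← Matrix.mul_assoc Qᵀ, hQ, Matrix.one_mul]

theorem trace_outer {k : ℕ} {Q : Matrix (Fin n) (Fin k) ℝ} (hQ : Qᵀ * Q = 1) :
    (outer Q).1.trace = k := by
  change (Q * Qᵀ).trace = k
  rw [Matrix.trace_mul_comm, hQ, Matrix.trace_one, Fintype.card_fin]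

/-- A minimizer of a differentiable function over the Fantope whose gradient has an eigengap is the
projection onto the bottom eigenspace of the gradient. -/
theorem IsFantopeOptimal.spectral_bounds {k : ℕ} (hk : 1 ≤ k) (hkn : k < n) {f : SymMat n → ℝ}
    (hf : Differentiable ℝ f) {X : SymMat n} (hopt : IsFantopeOptimal f k X) {δ M : ℝ}
    (hδ : 0 < δ) (hgap : HasEigengap f k X δ) (hM : spectralNorm₂ (gradient f X) ≤ M) :
    X.1 * X.1 = X.1 ∧
      (∀ W : Matrix (Fin n) (Fin n) ℝ, W.PosSemidef →
        ((gradient f X).1 * W).trace ≤ eig (gradient f X) (n - k + 1) * W.trace +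
          (M - eig (gradient f X) (n - k + 1)) * (W.trace - (X.1 * W).trace) ∧
        eig (gradient f X) (n - k) * W.trace - (eig (gradient f X) (n - k) + M) * (X.1 * W).trace
          ≤ ((gradient f X).1 * W).trace) ∧
      ∀ Y ∈ fantope n k,
        δ * (k - (X.1 * Y.1).trace) ≤
          ((gradient f X).1 * Y.1).trace - ((gradient f X).1 * X.1).trace ∧
        ((gradient f X).1 * Y.1).trace - ((gradient f X).1 * X.1).trace ≤
          2 * M * (k - (X.1 * Y.1).trace) := by
  obtain ⟨P, hs, hi, ht, hW, hX⟩ := exists_bottom_eigenprojection hk hkn (gradient f X) hM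
  have hgap' : δ ≤ _ - _ := hgap
  -- Expand the square and use `Tr Y² ≤ Tr Y`.
  have hdist : ∀ Y ∈ fantope n k, ‖Y.1 - P‖ ^ 2 ≤ 2 * (k - (P * Y.1).trace) := by
    rintro Y ⟨hY0, hY1, hYt⟩
    have hYs : Y.1ᵀ = Y.1 := Y.2
    have h2 : 0 ≤ (Y.1 * (1 - Y.1)).trace := hY0.trace_mul_nonneg_real hY1
    rw [Matrix.frobenius_norm_sq_eq_trace, Matrix.transpose_sub, hs, hYs, Matrix.sub_mul,
      Matrix.mul_sub, Matrix.mul_sub, hi, Matrix.trace_sub, Matrix.trace_sub, Matrix.trace_sub,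
      Matrix.trace_mul_comm Y.1 P, ht]
    rw [Matrix.mul_sub, Matrix.mul_one, Matrix.trace_sub, hYt] at h2
    linarith
  have hPF : (⟨P, hs⟩ : SymMat n) ∈ fantope n k := proj_mem_fantope hi ht
  have hfo := inner_gradient_nonneg_of_isMinOn (convex_fantope n k) hf hopt.1 hPF hopt.2
  have hfo' : 0 ≤ ((gradient f X).1 * P).trace - ((gradient f X).1 * X.1).trace := by
    rw [Submodule.coe_inner, Matrix.inner_eq_trace] at hfo
    have e : (gradient f X).1ᵀ = (gradient f X).1 := (gradient f X).2
    rw [e] at hfo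
    rwa [← Matrix.trace_sub, ← Matrix.mul_sub]
  -- Optimality of `X` tested against `P` and the gap bound point in opposite directions, so the
  -- deficit of `X` vanishes.
  have hXP : X.1 = P := by
    have h1 := hdist X hopt.1
    have h2 := (hX X hopt.1).1
    have h3 : ‖X.1 - P‖ ^ 2 ≤ 0 := by nlinarith
    have h4 : ‖X.1 - P‖ = 0 := by
      nlinarith [norm_nonneg (X.1 - P)]
    exact sub_eq_zero.1 (norm_eq_zero.1 h4)
  rw [hXP]
  refine ⟨hi, hW, fun Y hY => ⟨le_trans ?_ (hX Y hY).1, (hX Y hY).2⟩⟩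
  have h1 := hdist Y hY
  exact mul_le_mul_of_nonneg_right hgap' (by nlinarith [sq_nonneg ‖Y.1 - P‖])

end EigenProjection

/-! ### Projection estimates for one iteration. -/

section OrthogonalIteration

theorem Matrix.norm_sub_sq_of_proj {ι : Type*} [Fintype ι] {P R : Matrix ι ι ℝ} (hPs : Pᵀ = P) (hPi : P * P = P)
    (hRs : Rᵀ = R) (hRi : R * R = R) (htr : P.trace = R.trace) :
    ‖P - R‖ ^ 2 = 2 * (P.trace - (R * P).trace) := by
  rw [Matrix.frobenius_norm_sq_eq_trace, Matrix.transpose_sub, hPs, hRs, Matrix.sub_mul,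
    Matrix.mul_sub, Matrix.mul_sub, hPi, hRi, Matrix.trace_sub, Matrix.trace_sub, Matrix.trace_sub,
    Matrix.trace_mul_comm P R, htr]
  ring

/-- Upper bound on `⟨g, P - R⟩` for projections `P` and `R` of the same trace, where `R` is the
bottom eigenprojection of `h`, in terms of the off-diagonal block of `g` with respect to `P`. -/
theorem Matrix.trace_mul_sub_proj_le {ι : Type*} [Fintype ι] [DecidableEq ι]
    {g h P R : Matrix ι ι ℝ} (hgs : gᵀ = g) (hhs : hᵀ = h)
    (hPs : Pᵀ = P) (hPi : P * P = P) (hRs : Rᵀ = R) (hRi : R * R = R) (htr : P.trace = R.trace)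
    {μ ν M : ℝ} (hμ : μ ≤ M) (hν : 0 ≤ ν + M)
    (hub : ∀ W : Matrix ι ι ℝ, W.PosSemidef →
      (h * W).trace ≤ μ * W.trace + (M - μ) * (W.trace - (R * W).trace))
    (hlb : ∀ W : Matrix ι ι ℝ, W.PosSemidef →
      ν * W.trace - (ν + M) * (R * W).trace ≤ (h * W).trace)
    {q : ℝ} (hq : 0 ≤ q) (hq2 : ‖P - R‖ ^ 2 = 2 * q ^ 2) :
    (g * (P - R)).trace ≤ 2 * ‖(1 - P) * g * P‖ * q - (ν - μ) * (q ^ 2 - (q ^ 2) ^ 2)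
      + 2 * M * (q ^ 2) ^ 2 + 2 * ‖g - h‖ * q ^ 2 := by
  -- Blocks of `P - R` relative to `P`: diagonal ones `Bᵀ * B` and `-(Cᵀ * C)`, of trace `±q²`, and
  -- off-diagonal ones `-b`, `-bᵀ`, of norm at most `q`. Only the latter are of first order in `q`.
  set B := (1 - R) * P with hB
  set C := R * (1 - P) with hC
  set b := (1 - P) * R * P with hb
  have hPp : (1 - P) * (1 - P) = 1 - P := by
    rw [Matrix.sub_mul, Matrix.mul_sub, Matrix.mul_sub, hPi]; simp
  have hRp : (1 - R) * (1 - R) = 1 - R := by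
    rw [Matrix.sub_mul, Matrix.mul_sub, Matrix.mul_sub, hRi]; simp
  have hPps : (1 - P)ᵀ = 1 - P := by rw [Matrix.transpose_sub, hPs, Matrix.transpose_one]
  have hRps : (1 - R)ᵀ = 1 - R := by rw [Matrix.transpose_sub, hRs, Matrix.transpose_one]
  have hT : Bᵀ * B = P * (1 - R) * P := by
    rw [hB, Matrix.transpose_mul, hPs, hRps, Matrix.mul_assoc, ← Matrix.mul_assoc (1 - R), hRp,
      Matrix.mul_assoc]
  have hD : Cᵀ * C = (1 - P) * R * (1 - P) := by
    rw [hC, Matrix.transpose_mul, hRs, hPps, Matrix.mul_assoc, ← Matrix.mul_assoc R, hRi,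
      Matrix.mul_assoc]
  have hq2' : P.trace - (R * P).trace = q ^ 2 := by
    have := Matrix.norm_sub_sq_of_proj hPs hPi hRs hRi htr
    linarith
  have htrT : (Bᵀ * B).trace = q ^ 2 := by
    rw [hT, Matrix.trace_mul_comm, ← Matrix.mul_assoc, hPi, Matrix.mul_sub, Matrix.mul_one,
      Matrix.trace_sub, Matrix.trace_mul_comm P R, hq2']
  have htrD : (Cᵀ * C).trace = q ^ 2 := by
    rw [hD, Matrix.trace_mul_comm, ← Matrix.mul_assoc, hPp, Matrix.sub_mul, Matrix.one_mul,
      Matrix.trace_sub, Matrix.trace_mul_comm P R, ← htr, hq2']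
  have hBn : ‖B‖ ^ 2 = q ^ 2 := by rw [Matrix.frobenius_norm_sq_eq_trace, htrT]
  have hCn : ‖C‖ ^ 2 = q ^ 2 := by rw [Matrix.frobenius_norm_sq_eq_trace, htrD]
  have hTn : ‖Bᵀ * B‖ ≤ q ^ 2 := by
    refine (Matrix.frobenius_norm_mul _ _).trans_eq ?_
    rw [Matrix.frobenius_norm_transpose, ← sq, hBn]
  have hDn : ‖Cᵀ * C‖ ≤ q ^ 2 := by
    refine (Matrix.frobenius_norm_mul _ _).trans_eq ?_
    rw [Matrix.frobenius_norm_transpose, ← sq, hCn]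
  have hbn : ‖b‖ ≤ q := by
    have h1 : b = Cᵀ * P := by rw [hb, hC, Matrix.transpose_mul, hRs, hPps]
    rw [h1]
    refine (Matrix.frobenius_norm_mul_proj_le hPs hPi _).trans ?_
    rw [Matrix.frobenius_norm_transpose]
    exact (abs_le_of_sq_le_sq' hCn.le hq).2
  have hsplit : P - R = Bᵀ * B - Cᵀ * C - b - bᵀ := by
    have hbt : bᵀ = P * R * (1 - P) := by
      rw [hb, Matrix.transpose_mul, Matrix.transpose_mul, hPs, hRs, hPps, Matrix.mul_assoc]
    rw [hbt, hT, hD, hb]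
    have e : P * (1 - R) * P = P - P * R * P := by
      rw [Matrix.mul_sub, Matrix.sub_mul, Matrix.mul_one, hPi]
    rw [e]
    noncomm_ring
  have hgb : (g * b).trace = inner ℝ ((1 - P) * g * P) b := by
    rw [Matrix.inner_eq_trace, Matrix.transpose_mul, Matrix.transpose_mul, hgs, hPs, hPps, hb]
    have e : P * (g * (1 - P)) * ((1 - P) * R * P) = P * (g * ((1 - P) * (1 - P)) * R * P) := by
      simp only [Matrix.mul_assoc]
    rw [e, Matrix.trace_mul_comm P, hPp, Matrix.mul_assoc _ P P, hPi]
    simp only [Matrix.mul_assoc]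
  have hgbt : (g * bᵀ).trace = (g * b).trace := by
    rw [← Matrix.trace_transpose (g * b), Matrix.transpose_mul g b, hgs, Matrix.trace_mul_comm]
  have hb1 : -(‖(1 - P) * g * P‖ * q) ≤ (g * b).trace := by
    rw [hgb]
    have h1 := neg_le_of_abs_le (abs_real_inner_le_norm ((1 - P) * g * P) b)
    nlinarith [mul_le_mul_of_nonneg_left hbn (norm_nonneg ((1 - P) * g * P))]
  -- Up to mass `q⁴`, `Bᵀ * B` lives on the range of `R` and, by `hpar`, `Cᵀ * C` on its complement.
  -- So `h` weighs them by at most `μ` and at least `ν`, up to order `q⁴`.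
  have hperp : (Bᵀ * B).trace - (R * (Bᵀ * B)).trace = ‖Bᵀ * B‖ ^ 2 := by
    rw [Matrix.frobenius_norm_sq_eq_trace, Matrix.transpose_mul Bᵀ B, Matrix.transpose_transpose B, hT,
      ← Matrix.trace_sub]
    have e : P * (1 - R) * P * (P * (1 - R) * P) = P * ((1 - R) * (P * P) * (1 - R) * P) := by
      simp only [Matrix.mul_assoc]
    rw [e, hPi, Matrix.trace_mul_comm P, Matrix.mul_assoc _ P P, hPi]
    have e2 : (1 - R) * P * (1 - R) * P = (1 - R) * (P * (1 - R) * P) := by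
      simp only [Matrix.mul_assoc]
    rw [e2, Matrix.sub_mul 1 R, Matrix.one_mul]
  have hpar : (R * (Cᵀ * C)).trace = ‖Cᵀ * C‖ ^ 2 := by
    rw [Matrix.frobenius_norm_sq_eq_trace, Matrix.transpose_mul Cᵀ C, Matrix.transpose_transpose C, hD]
    have e : (1 - P) * R * (1 - P) * ((1 - P) * R * (1 - P))
        = (1 - P) * (R * ((1 - P) * (1 - P)) * R * (1 - P)) := by
      simp only [Matrix.mul_assoc]
    rw [e, hPp, Matrix.trace_mul_comm (1 - P), Matrix.mul_assoc _ (1 - P) (1 - P), hPp]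
    simp only [Matrix.mul_assoc]
  have hu := hub _ (Matrix.PosSemidef.transpose_mul_self_real B)
  have hl := hlb _ (Matrix.PosSemidef.transpose_mul_self_real C)
  rw [hperp, htrT] at hu
  rw [hpar, htrD] at hl
  have hT2 : ‖Bᵀ * B‖ ^ 2 ≤ (q ^ 2) ^ 2 := pow_le_pow_left₀ (norm_nonneg _) hTn 2
  have hD2 : ‖Cᵀ * C‖ ^ 2 ≤ (q ^ 2) ^ 2 := pow_le_pow_left₀ (norm_nonneg _) hDn 2
  have hu' := mul_le_mul_of_nonneg_left hT2 (sub_nonneg.2 hμ)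
  have hl' := mul_le_mul_of_nonneg_left hD2 hν
  have hcross : ((g - h) * (Bᵀ * B - Cᵀ * C)).trace ≤ 2 * ‖g - h‖ * q ^ 2 := by
    have h1 := real_inner_le_norm (g - h) (Bᵀ * B - Cᵀ * C)
    rw [Matrix.inner_eq_trace, Matrix.transpose_sub, hgs, hhs] at h1
    have h2 : ‖Bᵀ * B - Cᵀ * C‖ ≤ 2 * q ^ 2 := (norm_sub_le _ _).trans (by linarith)
    nlinarith [mul_le_mul_of_nonneg_left h2 (norm_nonneg (g - h))]
  have hexp : (g * (P - R)).trace = (h * (Bᵀ * B)).trace - (h * (Cᵀ * C)).trace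
      + ((g - h) * (Bᵀ * B - Cᵀ * C)).trace - 2 * (g * b).trace := by
    rw [hsplit]
    simp only [Matrix.mul_sub, Matrix.sub_mul, Matrix.trace_sub, hgbt]
    ring
  rw [hexp]
  linarith

/-- If `R` fixes the range of `A P`, then `⟨A, R - P⟩` is the squared `A`-norm of `R - P`. -/
theorem Matrix.trace_mul_sub_proj_eq {ι : Type*} [Fintype ι] {A P R : Matrix ι ι ℝ} (hAs : Aᵀ = A) (hPs : Pᵀ = P)
    (hPi : P * P = P) (hRs : Rᵀ = R) (hRi : R * R = R) (hfix : R * (A * P) = A * P) :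
    (A * (R - P)).trace = ((R - P) * (A * (R - P))).trace := by
  have h1 : (R * (A * P)).trace = (A * P).trace := by rw [hfix]
  have h2 : (P * (A * R)).trace = (A * P).trace := by
    rw [← Matrix.trace_transpose, Matrix.transpose_mul, Matrix.transpose_mul, hAs, hPs, hRs,
      Matrix.mul_assoc, hfix]
  have h3 : (P * (A * P)).trace = (A * P).trace := by
    rw [Matrix.trace_mul_comm, Matrix.mul_assoc, hPi]
  have h4 : (R * (A * R)).trace = (A * R).trace := by
    rw [Matrix.trace_mul_comm, Matrix.mul_assoc, hRi]
  simp only [Matrix.mul_sub, Matrix.sub_mul, Matrix.trace_sub, h1, h2, h3, h4]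
  ring

/-- With `A = 1 - η g` and `E = R - P`, equality of traces gives `-η⟨g, E⟩ = ⟨A, E⟩ = ⟨E, A E⟩ ≥
(4/5)‖E‖²`. For the residual, `-η (1 - P) g P = (1 - P) E A P`, of norm at most `(6/5)‖E‖`. Dividing
by `η = 1 / (5M)` yields the constants 4 and 6. -/
theorem Matrix.iteration_step_bounds {ι : Type*} [Fintype ι] [DecidableEq ι]
    {g P R : Matrix ι ι ℝ} {M η : ℝ} (hη : 0 < η)
    (hηM : η * M = 1 / 5) (hgs : gᵀ = g) (hPs : Pᵀ = P) (hPi : P * P = P) (hRs : Rᵀ = R)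
    (hRi : R * R = R) (htr : P.trace = R.trace)
    (hop : ∀ C : Matrix ι ι ℝ, ‖g * C‖ ≤ M * ‖C‖)
    (hfix : R * ((1 - η • g) * P) = (1 - η • g) * P) :
    (g * (R - P)).trace ≤ -(4 * M) * ‖R - P‖ ^ 2 ∧
      ‖(1 - P) * g * P‖ ≤ 6 * M * ‖R - P‖ := by
  set A := 1 - η • g with hA
  set E := R - P with hE
  have hAs : Aᵀ = A := by rw [hA, Matrix.transpose_sub, Matrix.transpose_smul, hgs,
    Matrix.transpose_one]
  have hEs : Eᵀ = E := by rw [hE, Matrix.transpose_sub, hRs, hPs]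
  have hgE := hop E
  constructor
  · have h1 := Matrix.trace_mul_sub_proj_eq hAs hPs hPi hRs hRi hfix
    have h2 : (A * E).trace = -(η * (g * E).trace) := by
      rw [hA, Matrix.sub_mul, Matrix.one_mul, Matrix.trace_sub, Matrix.smul_mul,
        Matrix.trace_smul, hE, Matrix.trace_sub, htr, smul_eq_mul]
      ring
    have h3 : (E * (A * E)).trace = ‖E‖ ^ 2 - η * inner ℝ E (g * E) := by
      rw [Matrix.inner_eq_trace, Matrix.frobenius_norm_sq_eq_trace, hEs, hA, Matrix.sub_mul 1 (η • g),
        Matrix.one_mul, Matrix.mul_sub E, Matrix.trace_sub, Matrix.smul_mul, Matrix.mul_smul,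
        Matrix.trace_smul, smul_eq_mul]
    have h4 : inner ℝ E (g * E) ≤ M * ‖E‖ ^ 2 := by
      have := real_inner_le_norm E (g * E)
      nlinarith [mul_le_mul_of_nonneg_left hgE (norm_nonneg E)]
    have h5 : η * inner ℝ E (g * E) ≤ 1 / 5 * ‖E‖ ^ 2 := by
      rw [← hηM, mul_assoc]
      exact mul_le_mul_of_nonneg_left h4 hη.le
    have h6 : η * (g * E).trace ≤ η * (-(4 * M) * ‖E‖ ^ 2) := by
      have : η * (-(4 * M) * ‖E‖ ^ 2) = -4 * (η * M) * ‖E‖ ^ 2 := by ring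
      rw [this, hηM]
      linarith
    exact le_of_mul_le_mul_left h6 hη
  · have hPps : (1 - P)ᵀ = 1 - P := by rw [Matrix.transpose_sub, hPs, Matrix.transpose_one]
    have hPp : (1 - P) * (1 - P) = 1 - P := by
      rw [Matrix.sub_mul, Matrix.mul_sub, Matrix.mul_sub, hPi]; simp
    have hPP : (1 - P) * P = 0 := by rw [Matrix.sub_mul, hPi, Matrix.one_mul, sub_self]
    have h1 : -(η • ((1 - P) * g * P)) = (1 - P) * (E * A * P) := by
      have e1 : (1 - P) * (A * P) = -(η • ((1 - P) * g * P)) := by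
        rw [hA, Matrix.sub_mul 1 (η • g), Matrix.mul_sub, Matrix.one_mul, hPP, Matrix.smul_mul,
          Matrix.mul_smul, Matrix.mul_assoc, zero_sub]
      have e2 : (1 - P) * (E * A * P) = (1 - P) * (R * (A * P)) - (1 - P) * P * (A * P) := by
        rw [hE]
        simp only [Matrix.sub_mul, Matrix.mul_sub, Matrix.mul_assoc]
      rw [e2, hPP, hfix, e1, Matrix.zero_mul, sub_zero]
    have h2 : η * ‖(1 - P) * g * P‖ ≤ ‖E * A‖ := by
      have e : η * ‖(1 - P) * g * P‖ = ‖-(η • ((1 - P) * g * P))‖ := by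
        rw [norm_neg, norm_smul, Real.norm_of_nonneg hη.le]
      rw [e, h1]
      exact (Matrix.frobenius_norm_proj_mul_le hPps hPp _).trans
        (Matrix.frobenius_norm_mul_proj_le hPs hPi _)
    have h3 : ‖E * A‖ ≤ ‖E‖ + η * (M * ‖E‖) := by
      rw [← Matrix.frobenius_norm_transpose, Matrix.transpose_mul, hAs, hEs, hA, Matrix.sub_mul,
        Matrix.one_mul, Matrix.smul_mul]
      refine (norm_sub_le _ _).trans ?_
      rw [norm_smul, Real.norm_of_nonneg hη.le]
      gcongr
    have h4 : η * ‖(1 - P) * g * P‖ ≤ η * (6 * M * ‖E‖) := by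
      have e : η * (6 * M * ‖E‖) = 6 * (η * M) * ‖E‖ := by ring
      rw [← mul_assoc, hηM] at h3
      rw [e, hηM]
      linarith
    exact le_of_mul_le_mul_left h4 hη

end OrthogonalIteration

/-! ### Contraction of the optimality gap in one step. -/

section Convergence

variable {n : ℕ}

theorem abs_eig_le (A : SymMat n) (i : ℕ) : |eig A i| ≤ spectralNorm₂ A := by
  rw [eig]
  split_ifs with h
  · have h1 := A.isHermitian.abs_eigenvalues_le ((Fintype.equivOfCardEq (Fintype.card_fin _))
      ⟨i - 1, by rw [Fintype.card_fin]; omega⟩)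
    rwa [Matrix.IsHermitian.eigenvalues, Equiv.symm_apply_apply] at h1
  · simp [spectralNorm₂]

theorem SymMat.inner_eq_trace (A B : SymMat n) : inner ℝ A B = (A.1 * B.1).trace := by
  have h : A.1ᵀ = A.1 := A.2
  rw [Submodule.coe_inner, Matrix.inner_eq_trace, h]

theorem norm_outer_sub_sq {k : ℕ} {Q : Matrix (Fin n) (Fin k) ℝ} (hQ : Qᵀ * Q = 1) {X : SymMat n}
    (hi : X.1 * X.1 = X.1) (ht : X.1.trace = k) :
    ‖outer Q - X‖ ^ 2 = 2 * (k - (X.1 * (outer Q).1).trace) := by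
  have h := Matrix.norm_sub_sq_of_proj (outer Q).2 (outer_mul_self hQ) X.2 hi
    ((trace_outer hQ).trans ht.symm)
  rwa [trace_outer hQ] at h

/-- The scalar inequalities behind one step of gradient orthogonal iteration. -/
theorem mul_optimalityGap_le {δ M γ s h o x d : ℝ} (hδ : 0 < δ) (hM : 0 < M) (hs0 : 0 ≤ s)
    (hsM : 200 * M * s ≤ 3 * δ) (hs1 : 100 * s ≤ 3) (hγ : δ ≤ γ) (ho0 : 0 ≤ o)
    (hd : o ≤ 6 * M * d)
    (hh : h ≤ 2 * o * Real.sqrt s - γ * (s - s ^ 2) + 2 * M * s ^ 2 + 2 * x * s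
      - x ^ 2 / (2 * M)) : δ / (40 * M) * h ≤ 7 / 2 * M * d ^ 2 := by
  -- The cocoercivity term pays for the change of gradient, leaving an error quadratic in `s`.
  have hx : 2 * x * s ≤ x ^ 2 / (2 * M) + 2 * M * s ^ 2 := by
    rw [← sub_nonneg]
    have : x ^ 2 / (2 * M) + 2 * M * s ^ 2 - 2 * x * s = (x - 2 * M * s) ^ 2 / (2 * M) := by
      field_simp
      ring
    rw [this]
    positivity
  have hMs : 4 * M * s ^ 2 ≤ 3 / 50 * (δ * s) := by
    linarith [mul_le_mul_of_nonneg_right hsM hs0]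
  have hδs : δ * s - 3 / 100 * (δ * s) ≤ γ * (s - s ^ 2) := by
    have h1 : s - 3 / 100 * s ≤ s - s ^ 2 := by nlinarith
    calc δ * s - 3 / 100 * (δ * s) = δ * (s - 3 / 100 * s) := by ring
      _ ≤ δ * (s - s ^ 2) := mul_le_mul_of_nonneg_left h1 hδ.le
      _ ≤ γ * (s - s ^ 2) := mul_le_mul_of_nonneg_right hγ (by nlinarith)
  -- `91 = 100 - 3 - 6`, the losses in `hδs` and `hMs`. Next, `hPL` completes the square in `√s`.
  have hmain : h ≤ 2 * o * Real.sqrt s - 91 / 100 * δ * s := by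
    linarith
  have hPL : 91 / 100 * δ * h ≤ o ^ 2 := by
    have h1 := mul_le_mul_of_nonneg_left hmain (by positivity : 0 ≤ 91 / 100 * δ)
    have h2 := Real.sq_sqrt hs0
    have h3 : (91 / 100 * δ) * (2 * o * Real.sqrt s - 91 / 100 * δ * s)
        = o ^ 2 - (o - 91 / 100 * δ * Real.sqrt s) ^ 2 := by
      nth_rewrite 2 [← h2]
      ring
    linarith [sq_nonneg (o - 91 / 100 * δ * Real.sqrt s)]
  have ho2 : o ^ 2 ≤ 36 * M ^ 2 * d ^ 2 := by
    have := pow_le_pow_left₀ ho0 hd 2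
    linarith
  have hdec : δ * h ≤ 40 * M * (7 / 2 * M * d ^ 2) := by
    linarith [mul_nonneg (sq_nonneg M) (sq_nonneg d)]
  rw [div_mul_eq_mul_div, div_le_iff₀ (by positivity)]
  linarith

/-- One step of gradient orthogonal iteration contracts the optimality gap, once that gap is small
relative to the eigengap at the minimizer. -/
theorem gradientOrthogonalIteration_step {k : ℕ} (hk : 1 ≤ k) (hkn : k < n) {f : SymMat n → ℝ}
    (hconv : ConvexOn ℝ Set.univ f) (hf : Differentiable ℝ f) {M δ η : ℝ} (hM : 0 < M)
    (hη : η * M = 1 / 5)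
    (hlip : ∀ X Y, ‖gradient f X - gradient f Y‖ ≤ M * ‖X - Y‖)
    (hbdd : ∀ X ∈ fantope n k, spectralNorm₂ (gradient f X) ≤ M)
    {X : SymMat n} (hopt : IsFantopeOptimal f k X) (hδ : 0 < δ) (hgap : HasEigengap f k X δ)
    {Q Q' : Matrix (Fin n) (Fin k) ℝ} {T : Matrix (Fin k) (Fin k) ℝ} (hQ : Qᵀ * Q = 1)
    (hQ' : Q'ᵀ * Q' = 1) (hT : Q' * T = Q - η • ((gradient f (outer Q)).1 * Q))
    (hclose : f (outer Q) - f X ≤ 3 * δ ^ 2 / (200 * M)) :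
    f (outer Q') - f X ≤ (1 - δ / (40 * M)) * (f (outer Q) - f X) := by
  obtain ⟨hXi, hXW, hXY⟩ := hopt.spectral_bounds hk hkn hf hδ hgap (hbdd X hopt.1)
  have hgap' : δ ≤ _ - _ := hgap
  have hμ := (abs_le.1 ((abs_eig_le (gradient f X) (n - k + 1)).trans (hbdd X hopt.1)))
  have hν := (abs_le.1 ((abs_eig_le (gradient f X) (n - k)).trans (hbdd X hopt.1)))
  set μ := eig (gradient f X) (n - k + 1)
  set ν := eig (gradient f X) (n - k)
  have hη0 : 0 < η := by
    by_contra h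
    nlinarith
  have hPF : outer Q ∈ fantope n k := proj_mem_fantope (outer_mul_self hQ) (trace_outer hQ)
  have hXt : X.1.trace = k := hopt.1.2.2
  set P := outer Q with hP
  set P' := outer Q' with hP'
  obtain ⟨s, hs⟩ : ∃ s : ℝ, s = k - (X.1 * P.1).trace := ⟨_, rfl⟩
  have hnorm : ‖P - X‖ ^ 2 = 2 * s := by rw [hs]; exact norm_outer_sub_sq hQ hXi hXt
  have hs0 : 0 ≤ s := by nlinarith [sq_nonneg ‖P - X‖]
  obtain ⟨h, hh⟩ : ∃ h : ℝ, h = f P - f X := ⟨_, rfl⟩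
  -- Quadratic growth turns the small gap into closeness of `P` to `X`.
  have hgrowth : δ * s ≤ h := by
    have h1 := hconv.add_inner_gradient_le hf X P
    have h2 := (hXY P hPF).1
    rw [SymMat.inner_eq_trace, Submodule.coe_sub, Matrix.mul_sub, Matrix.trace_sub] at h1
    rw [hs, hh]
    linarith
  have hsM : 200 * M * s ≤ 3 * δ := by
    rw [← hh] at hclose
    have h1 := hgrowth.trans hclose
    rw [le_div_iff₀ (by positivity)] at h1
    have : δ * (200 * M * s) ≤ δ * (3 * δ) := by linarith
    exact le_of_mul_le_mul_left this hδ
  have hs1 : 100 * s ≤ 3 := by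
    have h2 : δ ≤ 2 * M := by linarith
    have : M * (100 * s) ≤ M * 3 := by linarith
    exact le_of_mul_le_mul_left this hM
  have hcoc := hconv.add_inner_gradient_add_sq_le hM hf hlip P X
  have hstep := le_add_inner_gradient_add_sq hf hlip P P'
  have hgs : (gradient f P).1ᵀ = (gradient f P).1 := (gradient f P).2
  have hPi : P.1 * P.1 = P.1 := outer_mul_self hQ
  have hPt : P.1.trace = k := trace_outer hQ
  have hPX := Matrix.trace_mul_sub_proj_le hgs (gradient f X).2 P.2 hPi X.2 hXi
    (hPt.trans hXt.symm) hμ.2 (by linarith) (fun W hW => (hXW W hW).1)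
    (fun W hW => (hXW W hW).2) (Real.sqrt_nonneg s) (by rw [Real.sq_sqrt hs0]; exact hnorm)
  rw [Real.sq_sqrt hs0] at hPX
  -- The columns of `(1 - η g) Q` lie in the range of `Q'`, whether or not `T` is invertible.
  have hfix : P'.1 * ((1 - η • (gradient f P).1) * P.1) = (1 - η • (gradient f P).1) * P.1 := by
    have e : (1 - η • (gradient f P).1) * P.1 = Q' * T * Qᵀ := by
      change (1 - η • (gradient f P).1) * (Q * Qᵀ) = _
      rw [hT, ← Matrix.mul_assoc, Matrix.sub_mul 1, Matrix.one_mul, Matrix.smul_mul]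
    rw [e]
    change Q' * Q'ᵀ * (Q' * T * Qᵀ) = _
    have e2 : Q' * Q'ᵀ * (Q' * T * Qᵀ) = Q' * (Q'ᵀ * Q') * T * Qᵀ := by
      simp only [Matrix.mul_assoc]
    rw [e2, hQ', Matrix.mul_one]
  have hop : ∀ C : Matrix (Fin n) (Fin n) ℝ, ‖(gradient f P).1 * C‖ ≤ M * ‖C‖ := fun C =>
    (Matrix.frobenius_norm_mul_le_opNorm _ C).trans
      (mul_le_mul_of_nonneg_right (hbdd P hPF) (norm_nonneg C))
  obtain ⟨hd1, hd2⟩ := Matrix.iteration_step_bounds hη0 hη hgs P.2 hPi P'.2 (outer_mul_self hQ')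
    (hPt.trans (trace_outer hQ').symm) hop hfix
  rw [SymMat.inner_eq_trace, Submodule.coe_sub] at hstep hcoc
  have hneg : ((gradient f P).1 * (X.1 - P.1)).trace
      = -((gradient f P).1 * (P.1 - X.1)).trace := by
    rw [← neg_sub, Matrix.mul_neg, Matrix.trace_neg]
  have hnn : ‖(gradient f P).1 - (gradient f X).1‖ = ‖gradient f P - gradient f X‖ := rfl
  have hdd : ‖P'.1 - P.1‖ = ‖P' - P‖ := rfl
  rw [hneg] at hcoc
  rw [hnn] at hPX
  rw [hdd] at hd1 hd2
  set o := ‖(1 - P.1) * (gradient f P).1 * P.1‖ with ho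
  set x := ‖gradient f P - gradient f X‖
  set d := ‖P' - P‖
  have ho0 : 0 ≤ o := norm_nonneg _
  have hfin := mul_optimalityGap_le (x := x) hδ hM hs0 hsM hs1 hgap' ho0 hd2
    (show h ≤ _ by rw [hh]; linarith only [hcoc, hPX])
  rw [← hh]
  have e1 : (1 - δ / (40 * M)) * h = h - δ / (40 * M) * h := by ring
  rw [e1]
  -- The net decrease is `(4 - 1/2) M d²`, exactly what `hfin` bounds from below.
  linarith only [hstep, hd1, hfin, hh]

end Convergence

/-! ### Initialization and induction. -/

theorem theorem3 {n k : ℕ} (hk : 1 ≤ k) (hkn : k < n)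
    (f : SymMat n → ℝ) (β G δ η : ℝ)
    (hconv : ConvexOn ℝ Set.univ f) (hsmooth : IsSmoothWith f β)
    (Xstar : SymMat n) (hopt : IsFantopeOptimal f k Xstar)
    (hδ : 0 < δ) (hgap : HasEigengap f k Xstar δ)
    (hG : ∀ X ∈ fantope n k, spectralNorm₂ (gradient f X) ≤ G)
    (hη : η = 1 / (5 * max β G))
    (Q : ℕ → Matrix (Fin n) (Fin k) ℝ)
    (hQ : IsGradientOrthogonalIteration f η Q)
    (hinit : ‖outer (Q 1) - Xstar‖ ≤
      min 1 (Real.sqrt (δ / 2)) * (η * δ / (2 * (1 + η * β)))) :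
    ∀ t : ℕ, 1 ≤ t →
      f (outer (Q t)) - f Xstar ≤
        (f (outer (Q 1)) - f Xstar) * Real.exp (-(δ * ((t : ℝ) - 1) / (40 * max β G))) := by
  have hgap' : δ ≤ _ - _ := hgap
  obtain ⟨hf, hlip⟩ := hsmooth
  set M := max β G with hMdef
  have hbdd : ∀ X ∈ fantope n k, spectralNorm₂ (gradient f X) ≤ M := fun X hX =>
    (hG X hX).trans (le_max_right _ _)
  have hlipM : ∀ X Y, ‖gradient f X - gradient f Y‖ ≤ M * ‖X - Y‖ := fun X Y =>
    (hlip X Y).trans (mul_le_mul_of_nonneg_right (le_max_left _ _) (norm_nonneg _))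
  have hμ := abs_le.1 ((abs_eig_le (gradient f Xstar) (n - k + 1)).trans (hbdd Xstar hopt.1))
  have hν := abs_le.1 ((abs_eig_le (gradient f Xstar) (n - k)).trans (hbdd Xstar hopt.1))
  -- The gap lies between eigenvalues in `[-M, M]`, so `0 < δ ≤ 2M`.
  have hM : 0 < M := by linarith
  have hηM : η * M = 1 / 5 := by rw [hη]; field_simp
  have hη0 : 0 < η := by rw [hη]; positivity
  have hβ : 0 ≤ β := by
    by_contra hneg
    have hone : (⟨1, Matrix.isSymm_one⟩ : SymMat n) ≠ 0 := by
      intro h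
      have h2 : (1 : Matrix (Fin n) (Fin n) ℝ) ⟨0, by omega⟩ ⟨0, by omega⟩ = 0 :=
        congrFun (congrFun (congrArg Subtype.val h) _) _
      simp at h2
    have h1 := hlip ⟨1, Matrix.isSymm_one⟩ 0
    rw [sub_zero] at h1
    have h2 := norm_pos_iff.2 hone
    nlinarith [norm_nonneg (gradient f (⟨1, Matrix.isSymm_one⟩ : SymMat n) - gradient f 0)]
  obtain ⟨hXi, -, hXY⟩ := hopt.spectral_bounds hk hkn hf hδ hgap (hbdd Xstar hopt.1)
  have horth : ∀ t, 1 ≤ t → (Q t)ᵀ * Q t = 1 := by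
    intro t ht
    induction t, ht using Nat.le_induction with
    | base => exact hQ.1
    | succ t ht _ =>
      obtain ⟨R, hR⟩ := hQ.2 t ht
      exact hR.1
  have hdist : 10 * M * ‖outer (Q 1) - Xstar‖ ≤ δ := by
    have h1 : ‖outer (Q 1) - Xstar‖ ≤ η * δ / 2 := by
      refine hinit.trans ?_
      have h2 : η * δ / (2 * (1 + η * β)) ≤ η * δ / 2 := by
        apply div_le_div_of_nonneg_left (by positivity) (by positivity)
        nlinarith [mul_nonneg hη0.le hβ]
      have h3 : 0 ≤ η * δ / (2 * (1 + η * β)) := by positivity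
      refine (mul_le_mul_of_nonneg_right (min_le_left _ _) h3).trans ?_
      rwa [one_mul]
    have h2 := mul_le_mul_of_nonneg_left h1 (by positivity : 0 ≤ 10 * M)
    have h3 : 10 * M * (η * δ / 2) = 5 * (η * M) * δ := by ring
    rw [h3, hηM] at h2
    linarith
  have hQ1F : outer (Q 1) ∈ fantope n k :=
    proj_mem_fantope (outer_mul_self hQ.1) (trace_outer hQ.1)
  -- The linear term is at most `M‖·‖²` and smoothness adds `(M/2)‖·‖²`; the distance `δ / (10M)`
  -- then gives exactly this threshold.
  have hclose : f (outer (Q 1)) - f Xstar ≤ 3 * δ ^ 2 / (200 * M) := by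
    have h1 := le_add_inner_gradient_add_sq hf hlipM Xstar (outer (Q 1))
    have h2 := (hXY _ hQ1F).2
    have h3 := norm_outer_sub_sq hQ.1 hXi hopt.1.2.2
    rw [SymMat.inner_eq_trace, Submodule.coe_sub, Matrix.mul_sub, Matrix.trace_sub] at h1
    have h4 := pow_le_pow_left₀ (by positivity) hdist 2
    rw [le_div_iff₀ (by positivity)]
    have h5 : f (outer (Q 1)) - f Xstar ≤ 3 / 2 * M * ‖outer (Q 1) - Xstar‖ ^ 2 := by
      have h6 : M * ‖outer (Q 1) - Xstar‖ ^ 2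
          = 2 * M * (k - (Xstar.1 * (outer (Q 1)).1).trace) := by rw [h3]; ring
      linarith
    have h7 := mul_le_mul_of_nonneg_right h5 (by positivity : 0 ≤ 200 * M)
    linarith
  intro t ht
  induction t, ht using Nat.le_induction with
  | base => simp
  | succ t ht ih =>
    obtain ⟨R, hR⟩ := hQ.2 t ht
    have hnonneg : ∀ t, 1 ≤ t → 0 ≤ f (outer (Q t)) - f Xstar := fun t ht =>
      sub_nonneg.2 (hopt.2 _
        (proj_mem_fantope (outer_mul_self (horth t ht)) (trace_outer (horth t ht))))
    have ht1 : (0 : ℝ) ≤ t - 1 := by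
      rw [sub_nonneg]
      exact_mod_cast ht
    -- The induction hypothesis keeps the gap below its initial value, so the local estimate still
    -- applies.
    have hle : f (outer (Q t)) - f Xstar ≤ 3 * δ ^ 2 / (200 * M) := by
      refine (ih.trans ?_).trans hclose
      refine mul_le_of_le_one_right (hnonneg 1 le_rfl) (Real.exp_le_one_iff.2 ?_)
      rw [neg_nonpos]
      positivity
    have hstep := gradientOrthogonalIteration_step hk hkn hconv hf hM hηM hlipM hbdd hopt hδ hgap
      (horth t ht) hR.1 hR.2.2 hle
    have hexp : 1 - δ / (40 * M) ≤ Real.exp (-(δ / (40 * M))) := by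
      linarith [Real.add_one_le_exp (-(δ / (40 * M)))]
    calc f (outer (Q (t + 1))) - f Xstar
        ≤ Real.exp (-(δ / (40 * M))) * (f (outer (Q t)) - f Xstar) :=
          hstep.trans (mul_le_mul_of_nonneg_right hexp (hnonneg t ht))
      _ ≤ Real.exp (-(δ / (40 * M))) * ((f (outer (Q 1)) - f Xstar) *
            Real.exp (-(δ * ((t : ℝ) - 1) / (40 * M)))) :=
          mul_le_mul_of_nonneg_left ih (Real.exp_pos _).le
      _ = (f (outer (Q 1)) - f Xstar) *
            Real.exp (-(δ * (((t + 1 : ℕ) : ℝ) - 1) / (40 * M))) := by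
          rw [mul_left_comm, ← Real.exp_add]
          congr 2
          push_cast
          ring
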